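/- Let $\mathbb{D}=\{z\in\mathbb{C}:|z|<1\}$. Call a holomorphic function $f:\mathbb{D}\to\mathbb{C}$ normalised if $f(0)=0$ and $f'(0)=1$, and call a normalised $f$ a Bloch function if $|f'(z)|\le \dfrac{1}{1-|z|^2}$ for all $z\in\mathbb{D}$. Say that $f$ covers a schlicht disk of radius $R$ if there is a domain $\Omega\subset\mathbb{D}$ on which $f$ is one to one and whose image $f(\Omega)$ contains an open disk of radius $R$. Bloch's constant $B$ is the infimum, over all normalised $f$, of the supremum of the radii of the schlicht disks covered by $f$. Then: 1. For every Bloch function $f$ and every $w\in\mathbb{C}$ with $|w|<0.347493$, the equation $f(z)=w$ has exactly one solution $z$ with $|z|<0.45$. 2. Every normalised $f$ covers a schlicht disk of radius at least $0.347493$. 3. Consequently $B\ge 0.347493$. -/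

import Mathlib

open Metric Set
open scoped ENNReal NNReal

/-- `f` is a normalised analytic function on the open unit disk:
holomorphic there, with `f 0 = 0` and `f' 0 = 1`. Values outside the disk are irrelevant. -/
structure IsNormalised (f : ℂ → ℂ) : Prop where
  differentiableOn : DifferentiableOn ℂ f (ball 0 1)
  map_zero : f 0 = 0
  deriv_zero : deriv f 0 = 1

/-- A normalised function is a Bloch function (it satisfies Landau's simplification) if
`|f' z| ≤ 1 / (1 - |z|²)` throughout the unit disk. -/
structure IsBlochFunction (f : ℂ → ℂ) : Prop extends IsNormalised f where
  norm_deriv_le : ∀ z ∈ ball (0 : ℂ) 1, ‖deriv f z‖ ≤ 1 / (1 - ‖z‖ ^ 2)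

/-- `f` covers a schlicht disk of radius `R`: on some subdomain `Ω` of the unit disk `f` is
one to one, and `f '' Ω` contains an open disk of radius `R`. -/
def CoversSchlichtDisk (f : ℂ → ℂ) (R : ℝ) : Prop :=
  ∃ Ω : Set ℂ, Ω ⊆ ball 0 1 ∧ IsOpen Ω ∧ IsConnected Ω ∧ InjOn f Ω ∧
    ∃ c : ℂ, ball c R ⊆ f '' Ω

/-- The supremum of the radii of the schlicht disks covered by `f`. -/
noncomputable def schlichtRadius (f : ℂ → ℂ) : ℝ≥0∞ :=
  ⨆ (R : ℝ≥0) (_ : CoversSchlichtDisk f R), (R : ℝ≥0∞)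

/-- Bloch's constant: the infimum of `schlichtRadius f` over all normalised `f`. -/
noncomputable def blochConstant : ℝ≥0∞ :=
  ⨅ (f : ℂ → ℂ) (_ : IsNormalised f), schlichtRadius f

open Complex Filter Topology Asymptotics ComplexConjugate

/-! For a Bloch function, `1 / (1 - |z|²) - Re f'` has a minimum along each line through `0`, so
`f''(0) = 0`. A Schwarz lemma with a double zero then bounds `Re f'` below by a polynomial in `|z|`
(`le_re_deriv`). Positivity of this bound for `|z| ≤ 0.45` gives injectivity, and its radial
integral gives `|f| ≥ 0.349` on `|z| = 0.45`; a connectedness argument turns this into covering.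
Landau's reduction, on a disk of radius `ρ < 1` so that a maximum is attained, carries this to
normalised functions at the cost of a factor `ρ`. -/

/-! ### Injectivity and covering criteria. -/

/-- The derivative of the component of `f` in the direction `v` along the line `t ↦ a + t v`. -/
theorem hasDerivAt_re_conj_mul_comp_line {f : ℂ → ℂ} {a v : ℂ} {t : ℝ}
    (hf : DifferentiableAt ℂ f (a + t * v)) :
    HasDerivAt (fun s : ℝ => (conj v * f (a + s * v)).re)
      (‖v‖ ^ 2 * (deriv f (a + t * v)).re) t := by
  have h1 : HasDerivAt (fun s : ℂ => a + s * v) v (t : ℂ) := by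
    simpa using ((hasDerivAt_id (t : ℂ)).mul_const v).const_add a
  have h2 : HasDerivAt (fun s : ℂ => f (a + s * v)) (deriv f (a + t * v) * v) (t : ℂ) :=
    HasDerivAt.comp (t : ℂ) hf.hasDerivAt h1
  have h3 := (h2.const_mul (conj v)).real_of_complex
  have h4 : conj v * (deriv f (a + t * v) * v) = ((‖v‖ ^ 2 : ℝ) : ℂ) * deriv f (a + t * v) := by
    rw [← Complex.normSq_eq_norm_sq, ← Complex.mul_conj]; ring
  rwa [h4, Complex.re_ofReal_mul] at h3

/-- A holomorphic function whose derivative has positive real part on a convex open set is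
one to one there. -/
theorem injOn_of_re_deriv_pos {f : ℂ → ℂ} {s : Set ℂ} (hs : Convex ℝ s) (hso : IsOpen s)
    (hf : DifferentiableOn ℂ f s) (hpos : ∀ z ∈ s, 0 < (deriv f z).re) : InjOn f s := by
  intro a ha b hb hab
  by_contra hne
  have hv : 0 < ‖b - a‖ := norm_pos_iff.2 (sub_ne_zero.2 (Ne.symm hne))
  have hmem : ∀ t ∈ Icc (0 : ℝ) 1, a + t * (b - a) ∈ s := by
    intro t ht
    have := hs.add_smul_sub_mem ha hb ht
    simpa using this
  have hd : ∀ t ∈ Icc (0 : ℝ) 1, HasDerivAt (fun s : ℝ => (conj (b - a) * f (a + s * (b - a))).re)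
      (‖b - a‖ ^ 2 * (deriv f (a + t * (b - a))).re) t := fun t ht =>
    hasDerivAt_re_conj_mul_comp_line (hf.differentiableAt (hso.mem_nhds (hmem t ht)))
  -- The component of `f` along `b - a` strictly increases on the segment, so its endpoint values
  -- differ.
  have hmono := strictMonoOn_of_deriv_pos (convex_Icc (0 : ℝ) 1)
    (fun t ht => (hd t ht).continuousAt.continuousWithinAt) (fun t ht => by
      have ht' := interior_subset ht
      rw [(hd t ht').deriv]
      exact mul_pos (by positivity) (hpos _ (hmem t ht')))
  have := hmono (left_mem_Icc.2 zero_le_one) (right_mem_Icc.2 zero_le_one) zero_lt_one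
  simp [hab] at this

/-- A holomorphic function that is one to one on a ball is open on that ball. -/
theorem isOpen_image_of_injOn_ball {f : ℂ → ℂ} {c : ℂ} {r : ℝ} (hr : 0 < r)
    (hf : DifferentiableOn ℂ f (ball c r)) (hinj : InjOn f (ball c r)) :
    IsOpen (f '' ball c r) := by
  rcases (hf.analyticOnNhd isOpen_ball).is_constant_or_isOpen
    (convex_ball c r).isPreconnected with ⟨w, hw⟩ | h
  · exfalso
    have hc : c ∈ ball c r := mem_ball_self hr
    have hd : c + (r / 2 : ℝ) ∈ ball c r := by
      rw [mem_ball, dist_self_add_left, Complex.norm_real, Real.norm_eq_abs,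
        abs_of_pos (by positivity)]
      linarith
    have h1 := hinj hc hd ((hw _ hc).trans (hw _ hd).symm)
    have h2 : ((r / 2 : ℝ) : ℂ) = 0 := by simpa using h1
    have h3 := Complex.ofReal_eq_zero.1 h2
    linarith
  · exact h _ subset_rfl isOpen_ball

/-- If `f` is one to one and holomorphic on a ball, continuous up to its boundary, and at distance
at least `R` from `f c` on the boundary, then the image of the ball contains the ball of radius
`R` about `f c`. -/
theorem ball_subset_image_ball_of_injOn {f : ℂ → ℂ} {c : ℂ} {r R : ℝ} (hr : 0 < r)
    (hf : DifferentiableOn ℂ f (ball c r)) (hc : ContinuousOn f (closedBall c r))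
    (hinj : InjOn f (ball c r)) (hR : ∀ z ∈ sphere c r, R ≤ dist (f z) (f c)) :
    ball (f c) R ⊆ f '' ball c r := by
  rcases le_or_gt R 0 with hR0 | hR0
  · simp [ball_eq_empty.2 hR0]
  -- The image is open, and relatively closed in the target ball: a limit of image points is the
  -- image of a point of the closed ball, and the boundary is excluded by `hR`.
  refine (convex_ball (f c) R).isPreconnected.subset_of_closure_inter_subset
    (isOpen_image_of_injOn_ball hr hf hinj)
    ⟨f c, mem_ball_self hR0, mem_image_of_mem f (mem_ball_self hr)⟩ ?_
  rintro w ⟨hw, hwR⟩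
  have hcl : closure (f '' ball c r) ⊆ f '' closedBall c r :=
    closure_minimal (image_mono ball_subset_closedBall)
      ((isCompact_closedBall c r).image_of_continuousOn hc).isClosed
  obtain ⟨z, hz, rfl⟩ := hcl hw
  rcases (mem_closedBall.1 hz).lt_or_eq with h | h
  · exact mem_image_of_mem f h
  · exact absurd (mem_ball.1 hwR) (not_lt.2 (hR z h))

/-! ### Bounds on the derivative of a Bloch function. -/

theorem IsBlochFunction.differentiableOn_deriv {f : ℂ → ℂ} (hf : IsBlochFunction f) :
    DifferentiableOn ℂ (deriv f) (ball 0 1) :=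
  hf.differentiableOn.deriv isOpen_ball

/-- The second derivative of a Bloch function vanishes at the origin. -/
theorem IsBlochFunction.deriv_deriv_zero {f : ℂ → ℂ} (hf : IsBlochFunction f) :
    deriv (deriv f) 0 = 0 := by
  have hd : DifferentiableAt ℂ (deriv f) 0 :=
    hf.differentiableOn_deriv.differentiableAt (ball_mem_nhds _ one_pos)
  have key : ∀ u : ℂ, ‖u‖ = 1 → (u * deriv (deriv f) 0).re = 0 := by
    intro u hu
    have h1 : HasDerivAt (fun s : ℂ => s * u) u ((0 : ℝ) : ℂ) := by
      simpa using (hasDerivAt_id ((0 : ℝ) : ℂ)).mul_const u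
    have h2 : HasDerivAt (fun s : ℂ => deriv f (s * u)) (deriv (deriv f) 0 * u) ((0 : ℝ) : ℂ) :=
      HasDerivAt.comp_of_eq _ hd.hasDerivAt h1 (by simp)
    have h3 := h2.real_of_complex
    have h4 : HasDerivAt (fun s : ℝ => 1 / (1 - s ^ 2)) 0 (0 : ℝ) := by
      have := (((hasDerivAt_id' (0 : ℝ)).fun_pow 2).const_sub 1).fun_inv (by simp)
      simpa [one_div] using this
    have hmin : IsLocalMin (fun s : ℝ => 1 / (1 - s ^ 2) - (deriv f (s * u)).re) 0 := by
      filter_upwards [Ioo_mem_nhds (neg_one_lt_zero) (zero_lt_one (α := ℝ))] with s hs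
      have hn : ‖(s : ℂ) * u‖ = |s| := by simp [hu]
      have hb := hf.norm_deriv_le (s * u) (by
        rw [mem_ball_zero_iff, hn]; exact abs_lt.2 hs)
      rw [hn, sq_abs] at hb
      have := (Complex.re_le_norm _).trans hb
      simp only [ofReal_zero, zero_mul, hf.deriv_zero]
      norm_num at this ⊢
      linarith
    have := hmin.hasDerivAt_eq_zero (h4.sub h3)
    rw [mul_comm u]
    linarith
  have hA := key 1 (by simp)
  have hB := key I (by simp)
  apply Complex.ext
  · simpa using hA
  · simpa using hB

/-- The second order Schwarz lemma, normalised for a bounded function of value `1` and vanishing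
derivative at the origin. -/
theorem norm_sub_one_le_of_norm_lt {g : ℂ → ℂ} {r M : ℝ} (hM : 1 < M)
    (hg : DifferentiableOn ℂ g (ball 0 r)) (h0 : g 0 = 1) (h0' : deriv g 0 = 0)
    (hb : ∀ z ∈ ball (0 : ℂ) r, ‖g z‖ ≤ M) {z : ℂ} (hz : z ∈ ball (0 : ℂ) r) :
    M * ‖g z - 1‖ ≤ (‖z‖ / r) ^ 2 * ‖(M : ℂ) ^ 2 - g z‖ := by
  have hr : 0 < r := nonempty_ball.1 ⟨z, hz⟩
  have hne : ∀ w ∈ ball (0 : ℂ) r, (M : ℂ) ^ 2 - g w ≠ 0 := by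
    intro w hw h
    have h1 : ‖g w‖ = M ^ 2 := by
      rw [← sub_eq_zero.1 h, norm_pow, Complex.norm_real, Real.norm_eq_abs, sq_abs]
    have := hb w hw
    nlinarith
  -- This is `g / M` followed by the disk automorphism sending `1 / M` to `0`.
  set φ : ℂ → ℂ := fun w => M * (g w - 1) / ((M : ℂ) ^ 2 - g w) with hφ
  have hφ0 : φ 0 = 0 := by simp [hφ, h0]
  have hφd : DifferentiableOn ℂ φ (ball 0 r) :=
    ((hg.sub_const 1).const_mul (M : ℂ)).div (hg.const_sub _) hne
  have hmaps : MapsTo φ (ball 0 r) (closedBall (φ 0) 1) := by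
    intro w hw
    rw [hφ0, mem_closedBall_zero_iff, hφ, norm_div, div_le_one (norm_pos_iff.2 (hne w hw))]
    refine le_of_sq_le_sq ?_ (norm_nonneg _)
    have hbw : ‖g w‖ ^ 2 ≤ M ^ 2 := by gcongr; exact hb w hw
    rw [← Complex.normSq_eq_norm_sq, Complex.normSq_apply] at hbw ⊢
    rw [← Complex.normSq_eq_norm_sq, Complex.normSq_apply]
    have e1 : ((M : ℂ) ^ 2 - g w).re = M ^ 2 - (g w).re := by
      rw [← Complex.ofReal_pow, sub_re, ofReal_re]
    have e2 : ((M : ℂ) ^ 2 - g w).im = - (g w).im := by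
      rw [← Complex.ofReal_pow, sub_im, ofReal_im, zero_sub]
    rw [e1, e2]
    simp only [Complex.re_ofReal_mul, Complex.im_ofReal_mul, sub_re, one_re, sub_im, one_im]
    -- `|M² - g|² - M²|g - 1|² = (M² - 1)(M² - |g|²)`.
    nlinarith [mul_nonneg (sub_nonneg.2 (one_lt_pow₀ hM two_ne_zero).le) (sub_nonneg.2 hbw)]
  have h0mem : (0 : ℂ) ∈ ball 0 r := mem_ball_self hr
  have hgd : HasDerivAt g 0 0 := by
    simpa [h0'] using (hg.differentiableAt (ball_mem_nhds _ hr)).hasDerivAt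
  have hφd0 : HasDerivAt φ 0 0 := by
    have := ((hgd.sub_const 1).const_mul (M : ℂ)).fun_div (hgd.const_sub ((M : ℂ) ^ 2)) (hne 0 h0mem)
    simpa using this
  have hlo : (φ · - φ 0) =o[𝓝 0] (fun w : ℂ => ‖w - 0‖ ^ 1) := by
    have := hasDerivAt_iff_isLittleO.1 hφd0
    simpa using this.norm_right
  have := dist_le_mul_div_pow_of_mapsTo_ball_of_isLittleO hφd hmaps hlo hz
  rw [hφ0, dist_zero_right, dist_zero_right, one_mul, hφ, norm_div,
    div_le_iff₀ (norm_pos_iff.2 (hne z hz)), norm_mul, Complex.norm_real, Real.norm_eq_abs,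
    abs_of_pos (by linarith)] at this
  exact this

/-- Lower bound for the real part of the derivative of a Bloch function. -/
theorem IsBlochFunction.le_re_deriv {f : ℂ → ℂ} (hf : IsBlochFunction f) {z : ℂ}
    (hz : ‖z‖ ≤ 0.45) :
    1 - 8 / 3 * ‖z‖ ^ 2 - 4 * ‖z‖ ^ 4 - 75 / 8 * ‖z‖ ^ 6 ≤ (deriv f z).re := by
  -- The radius `√(2/5)` exceeds `0.45` and makes the Bloch bound the rational number `5 / 3`.
  have hr2 : √(2 / 5 : ℝ) ^ 2 = 2 / 5 := Real.sq_sqrt (by norm_num)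
  have hr0 : 0 < √(2 / 5 : ℝ) := Real.sqrt_pos.2 (by norm_num)
  have hr1 : √(2 / 5 : ℝ) < 1 := by nlinarith
  have hsub : ball (0 : ℂ) √(2 / 5) ⊆ ball 0 1 := ball_subset_ball hr1.le
  have hb : ∀ w ∈ ball (0 : ℂ) √(2 / 5), ‖deriv f w‖ ≤ 5 / 3 := by
    intro w hw
    have hw' : ‖w‖ ^ 2 < 2 / 5 := by
      rw [← hr2]; gcongr; exact mem_ball_zero_iff.1 hw
    refine (hf.norm_deriv_le w (hsub hw)).trans ?_
    rw [div_le_div_iff₀ (by linarith) (by norm_num)]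
    linarith
  have hzm : z ∈ ball (0 : ℂ) √(2 / 5) := by
    rw [mem_ball_zero_iff]; exact lt_of_le_of_lt hz (Real.lt_sqrt_of_sq_lt (by norm_num))
  have key := norm_sub_one_le_of_norm_lt (M := 5 / 3) (by norm_num)
    (hf.differentiableOn_deriv.mono hsub) hf.deriv_zero hf.deriv_deriv_zero hb hzm
  rw [div_pow, hr2] at key
  have hgz := hb z hzm
  have hx := (Complex.re_le_norm _).trans hgz
  set t := ‖z‖ ^ 2 with ht
  have ht0 : 0 ≤ t := sq_nonneg _
  have ht1 : t ≤ 0.2025 := by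
    have : ‖z‖ ^ 2 ≤ 0.45 ^ 2 := by gcongr
    norm_num at this ⊢; exact this
  have e4 : ‖z‖ ^ 4 = t ^ 2 := by rw [ht]; ring
  have e6 : ‖z‖ ^ 6 = t ^ 3 := by rw [ht]; ring
  rw [e4, e6]
  have hsq : (5 / 3 * ‖deriv f z - 1‖) ^ 2 ≤ (t / (2 / 5) * ‖((5 / 3 : ℝ) : ℂ) ^ 2 - deriv f z‖) ^ 2 := by
    gcongr
  rw [mul_pow, mul_pow, ← Complex.normSq_eq_norm_sq, ← Complex.normSq_eq_norm_sq,
    Complex.normSq_apply, Complex.normSq_apply, ← Complex.ofReal_pow] at hsq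
  simp only [sub_re, one_re, sub_im, one_im, ofReal_re, ofReal_im] at hsq
  set x := (deriv f z).re
  set y := (deriv f z).im
  -- This lets the imaginary part `y` be dropped from `hsq`.
  have hs : (t / (2 / 5)) ^ 2 ≤ (5 / 3) ^ 2 := by
    refine pow_le_pow_left₀ (by positivity) ?_ 2
    rw [div_le_iff₀ (by norm_num)]
    norm_num at ht1 ⊢
    linarith
  have h2 : (5 / 3 * (1 - x)) ^ 2 ≤ (t / (2 / 5) * ((5 / 3) ^ 2 - x)) ^ 2 := by
    nlinarith [mul_nonneg (sub_nonneg.2 hs) (sq_nonneg y)]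
  have h3 : 5 / 3 * (1 - x) ≤ t / (2 / 5) * ((5 / 3) ^ 2 - x) :=
    le_of_sq_le_sq h2 (mul_nonneg (by positivity) (by linarith))
  have h4 : 1 - 25 / 6 * t ≤ x * (1 - 3 / 2 * t) := by linarith
  -- The polynomial truncates the series of `(1 - 25/6 t) / (1 - 3/2 t)`; raising the cubic
  -- coefficient from `6` to `75 / 8` absorbs the tail for `t ≤ 0.2025`.
  have h5 : (1 - 8 / 3 * t - 4 * t ^ 2 - 75 / 8 * t ^ 3) * (1 - 3 / 2 * t) ≤ x * (1 - 3 / 2 * t) := by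
    refine le_trans ?_ h4
    have : 0 ≤ t ^ 3 := by positivity
    nlinarith [mul_nonneg this (sub_nonneg.2 ht1)]
  exact le_of_mul_le_mul_right h5 (by linarith)

theorem IsBlochFunction.re_deriv_pos {f : ℂ → ℂ} (hf : IsBlochFunction f) {z : ℂ}
    (hz : ‖z‖ ≤ 0.45) : 0 < (deriv f z).re := by
  refine lt_of_lt_of_le ?_ (hf.le_re_deriv hz)
  have h2 : ‖z‖ ^ 2 ≤ 0.45 ^ 2 := by gcongr
  have h4 : ‖z‖ ^ 4 ≤ 0.45 ^ 4 := by gcongr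
  have h6 : ‖z‖ ^ 6 ≤ 0.45 ^ 6 := by gcongr
  norm_num at h2 h4 h6 ⊢
  linarith

/-! ### Covering for Bloch functions. -/

theorem ball_subset_unit_ball : ball (0 : ℂ) 0.45 ⊆ ball 0 1 := ball_subset_ball (by norm_num)

theorem IsBlochFunction.injOn {f : ℂ → ℂ} (hf : IsBlochFunction f) :
    InjOn f (ball 0 0.45) :=
  injOn_of_re_deriv_pos (convex_ball _ _) isOpen_ball
    (hf.differentiableOn.mono ball_subset_unit_ball)
    fun _ hz => hf.re_deriv_pos (mem_ball_zero_iff.1 hz).le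

/-- A Bloch function is large on the circle of radius `0.45`. -/
theorem IsBlochFunction.le_norm {f : ℂ → ℂ} (hf : IsBlochFunction f) {z : ℂ}
    (hz : ‖z‖ = 0.45) : 0.349 ≤ ‖f z‖ := by
  set u : ℂ := z / (0.45 : ℝ) with hu
  have hu1 : ‖u‖ = 1 := by
    rw [hu, norm_div, hz, Complex.norm_real]; norm_num
  have hzu : z = ((0.45 : ℝ) : ℂ) * u := by
    rw [hu, mul_div_cancel₀]; exact Complex.ofReal_ne_zero.2 (by norm_num)
  have hn : ∀ t ∈ Icc (0 : ℝ) 0.45, ‖(0 : ℂ) + t * u‖ = t := by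
    intro t ht
    simp [hu1, abs_of_nonneg ht.1]
  have hd : ∀ t ∈ Icc (0 : ℝ) 0.45, HasDerivAt (fun s : ℝ => (conj u * f (0 + s * u)).re -
      (s - 8 / 9 * s ^ 3 - 4 / 5 * s ^ 5 - 75 / 56 * s ^ 7))
      ((deriv f (0 + t * u)).re - (1 - 8 / 3 * t ^ 2 - 4 * t ^ 4 - 75 / 8 * t ^ 6)) t := by
    intro t ht
    have h1 := hasDerivAt_re_conj_mul_comp_line (f := f) (a := 0) (v := u) (t := t)
      (hf.differentiableOn.differentiableAt (isOpen_ball.mem_nhds (by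
        rw [mem_ball_zero_iff, hn t ht]; exact lt_of_le_of_lt ht.2 (by norm_num))))
    rw [hu1, one_pow, one_mul] at h1
    have h2 := (((hasDerivAt_id' t).sub (((hasDerivAt_id' t).pow 3).const_mul (8 / 9))).sub
      (((hasDerivAt_id' t).pow 5).const_mul (4 / 5))).sub
      (((hasDerivAt_id' t).pow 7).const_mul (75 / 56))
    refine (h1.sub h2).congr_deriv ?_
    norm_num
    ring
  have hmono := monotoneOn_of_deriv_nonneg (convex_Icc (0 : ℝ) 0.45)
    (fun t ht => (hd t ht).continuousAt.continuousWithinAt)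
    (fun t ht => (hd t (interior_subset ht)).differentiableAt.differentiableWithinAt)
    (fun t ht => by
      have ht' := interior_subset ht
      rw [(hd t ht').deriv]
      have := hf.le_re_deriv (z := 0 + t * u) (by rw [hn t ht']; exact ht'.2)
      rw [hn t ht'] at this
      linarith)
  have h := hmono (left_mem_Icc.2 (by norm_num)) (right_mem_Icc.2 (by norm_num))
    (show (0 : ℝ) ≤ 0.45 by norm_num)
  simp only [Complex.ofReal_zero, zero_mul, add_zero, hf.map_zero, mul_zero, zero_re] at h
  rw [zero_add, ← hzu] at h
  have hle : (conj u * f z).re ≤ ‖f z‖ := by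
    refine (Complex.re_le_norm _).trans ?_
    rw [norm_mul, RCLike.norm_conj, hu1, one_mul]
  have hnum : (0.349 : ℝ) ≤ 0.45 - 8 / 9 * 0.45 ^ 3 - 4 / 5 * 0.45 ^ 5 - 75 / 56 * 0.45 ^ 7 := by
    norm_num
  linarith

/-- The image of the disk of radius `0.45` under a Bloch function contains the disk of radius
`0.349`. -/
theorem IsBlochFunction.ball_subset_image {f : ℂ → ℂ} (hf : IsBlochFunction f) :
    ball 0 0.349 ⊆ f '' ball 0 0.45 := by
  have := ball_subset_image_ball_of_injOn (c := 0) (R := 0.349) (by norm_num)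
    (hf.differentiableOn.mono ball_subset_unit_ball)
    (hf.differentiableOn.continuousOn.mono (closedBall_subset_ball (by norm_num)))
    hf.injOn (fun z hz => by
      rw [hf.map_zero, dist_zero_right]; exact hf.le_norm (mem_sphere_zero_iff_norm.1 hz))
  rwa [hf.map_zero] at this

/-! ### Landau's reduction. -/

/-- The Schwarz–Pick identity; it makes `(1 - |z|²)|F'(z)|` invariant under disk automorphisms. -/
theorem one_sub_norm_sq_mobius {b z : ℂ} (h : 1 + conj b * z ≠ 0) :
    1 - ‖(z + b) / (1 + conj b * z)‖ ^ 2 =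
      (1 - ‖b‖ ^ 2) * (1 - ‖z‖ ^ 2) / ‖1 + conj b * z‖ ^ 2 := by
  have h' : ‖1 + conj b * z‖ ^ 2 ≠ 0 := pow_ne_zero _ (norm_ne_zero_iff.2 h)
  rw [norm_div, div_pow, eq_div_iff h', sub_mul, div_mul_cancel₀ _ h', one_mul]
  simp only [← Complex.normSq_eq_norm_sq, Complex.normSq_apply, add_re, add_im, mul_re, mul_im,
    conj_re, conj_im, one_re, one_im]
  ring

/-- Landau's reduction: a normalised function becomes, up to an affine change of the target with
linear coefficient of norm at least `ρ`, a Bloch function after composition with a holomorphic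
self-map of the disk. -/
theorem IsNormalised.exists_isBlochFunction {f : ℂ → ℂ} (hf : IsNormalised f) {ρ : ℝ}
    (hρ0 : 0 < ρ) (hρ1 : ρ < 1) :
    ∃ (S : ℂ → ℂ) (d c : ℂ), DifferentiableOn ℂ S (ball 0 1) ∧ MapsTo S (ball 0 1) (ball 0 1) ∧
      ρ ≤ ‖c‖ ∧ IsBlochFunction fun z => (f (S z) - d) / c := by
  have hcont : ContinuousOn (fun w : ℂ => (ρ ^ 2 - ‖w‖ ^ 2) * ‖deriv f w‖) (closedBall 0 ρ) := by
    have : ContinuousOn (deriv f) (closedBall 0 ρ) :=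
      (hf.differentiableOn.deriv isOpen_ball).continuousOn.mono (closedBall_subset_ball hρ1)
    fun_prop
  obtain ⟨a, ha, hmax⟩ := (isCompact_closedBall (0 : ℂ) ρ).exists_isMaxOn
    ⟨0, mem_closedBall_self hρ0.le⟩ hcont
  have hmax' : ∀ w ∈ closedBall (0 : ℂ) ρ,
      (ρ ^ 2 - ‖w‖ ^ 2) * ‖deriv f w‖ ≤ (ρ ^ 2 - ‖a‖ ^ 2) * ‖deriv f a‖ := fun w hw => hmax hw
  have hm : ρ ^ 2 ≤ (ρ ^ 2 - ‖a‖ ^ 2) * ‖deriv f a‖ := by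
    simpa [hf.deriv_zero] using hmax' 0 (mem_closedBall_self hρ0.le)
  -- The maximised quantity is `ρ²` at the origin and `0` on the circle of radius `ρ`.
  have haρ : ‖a‖ < ρ := by
    refine lt_of_le_of_ne (mem_closedBall_zero_iff.1 ha) fun h => ?_
    rw [h, sub_self, zero_mul] at hm
    exact absurd hm (not_le.2 (by positivity))
  have hρc : (ρ : ℂ) ≠ 0 := Complex.ofReal_ne_zero.2 hρ0.ne'
  obtain ⟨b, hab⟩ : ∃ b : ℂ, a = ρ * b := ⟨a / ρ, by field_simp⟩
  have hna : ‖a‖ = ρ * ‖b‖ := by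
    rw [hab, norm_mul, Complex.norm_real, Real.norm_eq_abs, abs_of_pos hρ0]
  have hb : ‖b‖ < 1 := by
    rw [hna] at haρ
    exact lt_of_mul_lt_mul_left (by rwa [mul_one]) hρ0.le
  have hb2 : 0 < 1 - ‖b‖ ^ 2 := by nlinarith [norm_nonneg b]
  have hne : ∀ z ∈ ball (0 : ℂ) 1, 1 + conj b * z ≠ 0 := by
    intro z hz h
    have h1 : ‖conj b * z‖ = 1 := by
      rw [eq_neg_of_add_eq_zero_right h, norm_neg, norm_one]
    rw [norm_mul, RCLike.norm_conj] at h1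
    have := mem_ball_zero_iff.1 hz
    nlinarith [norm_nonneg b, norm_nonneg z]
  -- An automorphism of the unit disk scaled by `ρ`, taking `0` to the maximum point `a`.
  set S : ℂ → ℂ := fun z => ρ * ((z + b) / (1 + conj b * z)) with hS
  have hnS : ∀ z, ‖S z‖ = ρ * ‖(z + b) / (1 + conj b * z)‖ := by
    intro z
    rw [hS, norm_mul, Complex.norm_real, Real.norm_eq_abs, abs_of_pos hρ0]
  have hSderiv : ∀ z ∈ ball (0 : ℂ) 1,
      HasDerivAt S (ρ * ((1 - ‖b‖ ^ 2 : ℝ) / (1 + conj b * z) ^ 2)) z := by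
    intro z hz
    have h1 := ((hasDerivAt_id' z).add_const b).fun_div
      (((hasDerivAt_id' z).const_mul (conj b)).const_add 1) (hne z hz)
    refine (h1.const_mul (ρ : ℂ)).congr_deriv ?_
    congr 2
    rw [← Complex.normSq_eq_norm_sq, Complex.ofReal_sub, ← Complex.mul_conj, Complex.ofReal_one]
    ring
  have hSρ : ∀ z ∈ ball (0 : ℂ) 1, S z ∈ ball (0 : ℂ) ρ := by
    intro z hz
    rw [mem_ball_zero_iff, hnS]
    have h1 := one_sub_norm_sq_mobius (hne z hz)
    have h2 : 0 < (1 - ‖b‖ ^ 2) * (1 - ‖z‖ ^ 2) / ‖1 + conj b * z‖ ^ 2 := by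
      have hz' := mem_ball_zero_iff.1 hz
      have : 0 < 1 - ‖z‖ ^ 2 := by nlinarith [norm_nonneg z]
      have := norm_pos_iff.2 (hne z hz)
      positivity
    have h3 : ‖(z + b) / (1 + conj b * z)‖ < 1 := by
      rw [← h1] at h2
      exact lt_of_pow_lt_pow_left₀ 2 zero_le_one (by linarith)
    nlinarith
  have hS1 : MapsTo S (ball 0 1) (ball 0 1) := fun z hz => ball_subset_ball hρ1.le (hSρ z hz)
  have hSd : DifferentiableOn ℂ S (ball 0 1) := fun z hz =>
    (hSderiv z hz).differentiableAt.differentiableWithinAt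
  have hS0 : S 0 = a := by simp [hS, hab]
  have hcomp : ∀ z ∈ ball (0 : ℂ) 1, HasDerivAt (fun z => f (S z))
      (deriv f (S z) * (ρ * ((1 - ‖b‖ ^ 2 : ℝ) / (1 + conj b * z) ^ 2))) z := fun z hz =>
    HasDerivAt.comp z (hf.differentiableOn.differentiableAt
      (isOpen_ball.mem_nhds (hS1 hz))).hasDerivAt (hSderiv z hz)
  have h0 : (0 : ℂ) ∈ ball (0 : ℂ) 1 := mem_ball_self one_pos
  have hnorm : ∀ z ∈ ball (0 : ℂ) 1,
      ρ * (‖deriv f (S z) * (ρ * ((1 - ‖b‖ ^ 2 : ℝ) / (1 + conj b * z) ^ 2))‖ * (1 - ‖z‖ ^ 2)) =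
        (ρ ^ 2 - ‖S z‖ ^ 2) * ‖deriv f (S z)‖ := by
    intro z hz
    have h1 : ρ ^ 2 - ‖S z‖ ^ 2 = ρ ^ 2 * (1 - ‖(z + b) / (1 + conj b * z)‖ ^ 2) := by
      rw [hnS]; ring
    rw [h1, one_sub_norm_sq_mobius (hne z hz)]
    simp only [norm_mul, norm_div, norm_pow, Complex.norm_real, Real.norm_eq_abs]
    rw [abs_of_pos hρ0, abs_of_pos hb2]
    ring
  set c : ℂ := deriv f (S 0) * (ρ * ((1 - ‖b‖ ^ 2 : ℝ) / (1 + conj b * 0) ^ 2)) with hc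
  have hcn : ρ * ‖c‖ = (ρ ^ 2 - ‖a‖ ^ 2) * ‖deriv f a‖ := by
    have := hnorm 0 h0
    rw [← hc, hS0, norm_zero] at this
    linarith
  have hρc' : ρ ≤ ‖c‖ := by
    rw [← hcn, sq] at hm
    exact le_of_mul_le_mul_left hm hρ0
  have hcpos : 0 < ‖c‖ := hρ0.trans_le hρc'
  have hder : ∀ z ∈ ball (0 : ℂ) 1, HasDerivAt (fun z => (f (S z) - f a) / c)
      (deriv f (S z) * (ρ * ((1 - ‖b‖ ^ 2 : ℝ) / (1 + conj b * z) ^ 2)) / c) z := fun z hz =>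
    ((hcomp z hz).sub_const _).div_const c
  refine ⟨S, f a, c, hSd, hS1, hρc', ⟨⟨fun z hz =>
    (hder z hz).differentiableAt.differentiableWithinAt, by simp [hS0], ?_⟩, ?_⟩⟩
  · rw [(hder 0 h0).deriv, ← hc, div_self (norm_pos_iff.1 hcpos)]
  · intro z hz
    have hz' := mem_ball_zero_iff.1 hz
    have hz2 : 0 < 1 - ‖z‖ ^ 2 := by nlinarith [norm_nonneg z]
    rw [(hder z hz).deriv, norm_div, div_le_div_iff₀ hcpos hz2, one_mul]
    refine le_of_mul_le_mul_left ?_ hρ0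
    rw [hnorm z hz, hcn]
    exact hmax' _ (ball_subset_closedBall (hSρ z hz))

/-! ### Schlicht disks and Bloch's constant. -/

/-- Every normalised function covers a schlicht disk of radius `0.347493`. -/
theorem IsNormalised.coversSchlichtDisk {f : ℂ → ℂ} (hf : IsNormalised f) :
    CoversSchlichtDisk f 0.347493 := by
  -- Any `ρ < 1` with `0.349 ρ ≥ 0.347493` would do.
  obtain ⟨S, d, c, hSd, hS, hc, hB⟩ :=
    hf.exists_isBlochFunction (ρ := 0.999) (by norm_num) (by norm_num)
  have hcpos : 0 < ‖c‖ := lt_of_lt_of_le (by norm_num) hc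
  have hc0 : c ≠ 0 := norm_pos_iff.1 hcpos
  -- Injectivity of `(f ∘ S - d) / c` gives that of `f` on the image of `S`, and that of `S` itself.
  have hinj : InjOn f (S '' ball 0 0.45) := by
    rintro _ ⟨z, hz, rfl⟩ _ ⟨w, hw, rfl⟩ h
    rw [hB.injOn hz hw (by simp only [h])]
  have hSinj : InjOn S (ball 0 0.45) := fun z hz w hw h => hB.injOn hz hw (by simp only [h])
  have hSd' := hSd.mono ball_subset_unit_ball
  refine ⟨S '' ball 0 0.45, ?_, isOpen_image_of_injOn_ball (by norm_num) hSd' hSinj,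
    ⟨⟨S 0, mem_image_of_mem S (mem_ball_self (by norm_num))⟩,
      (convex_ball _ _).isPreconnected.image S hSd'.continuousOn⟩, hinj, d, ?_⟩
  · rintro _ ⟨z, hz, rfl⟩
    exact hS (ball_subset_unit_ball hz)
  · intro w hw
    have hw' : (w - d) / c ∈ ball (0 : ℂ) 0.349 := by
      rw [mem_ball_zero_iff, norm_div, div_lt_iff₀ hcpos]
      rw [mem_ball, dist_eq_norm] at hw
      norm_num at hw hc ⊢
      linarith
    obtain ⟨z, hz, hzw⟩ := hB.ball_subset_image hw'
    refine ⟨S z, mem_image_of_mem S hz, ?_⟩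
    simpa using (div_left_inj' hc0).1 hzw

theorem mainTheorem2 :
    (∀ f : ℂ → ℂ, IsBlochFunction f →
      ∀ w ∈ ball (0 : ℂ) 0.347493, ∃! z : ℂ, z ∈ ball (0 : ℂ) 0.45 ∧ f z = w) ∧
    (∀ f : ℂ → ℂ, IsNormalised f → CoversSchlichtDisk f 0.347493) ∧
    ENNReal.ofReal 0.347493 ≤ blochConstant := by
  refine ⟨fun f hf w hw => ?_, fun f hf => hf.coversSchlichtDisk, ?_⟩
  · obtain ⟨z, hz, hzw⟩ := hf.ball_subset_image (ball_subset_ball (by norm_num) hw)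
    exact ⟨z, ⟨hz, hzw⟩, fun y hy => hf.injOn hy.1 hz (hy.2.trans hzw.symm)⟩
  · refine le_iInf₂ fun f hf => ?_
    refine le_iSup₂_of_le (Real.toNNReal 0.347493) ?_ le_rfl
    rw [Real.coe_toNNReal _ (by norm_num)]
    exact hf.coversSchlichtDisk
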